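/- For an open set $\Omega\subset\mathbb{R}^n$, a $1$-field $F$ on $\Omega$ assigns to each $x\in\Omega$ a polynomial $F(x)(a)=f_x+\langle D_xf,a-x\rangle$, $a\in\mathbb{R}^n$, with $f_x\in\mathbb{R}$ and $D_xf\in\mathbb{R}^n$. Put $$\Gamma^1(F;\Omega)=\sup_{x\ne y\in\Omega}\;2\sup_{a\in\mathbb{R}^n}\frac{|F(x)(a)-F(y)(a)|}{\|x-a\|^2+\|y-a\|^2}\in[0,\infty],$$ and let $\mathcal{F}^1(\Omega)$ be the set of $1$-fields on $\Omega$ with $\Gamma^1(F;\Omega)<\infty$. For $F\in\mathcal{F}^1(\Omega)$ let $f(x)=F(x)(x)=f_x$, $x\in\Omega$; this function is differentiable on $\Omega$ with $\nabla f(x)=D_xf$. Put $\operatorname{Lip}(\nabla f;\Omega)=\sup_{x\neq y\in\Omega}\|\nabla f(x)-\nabla f(y)\|/\|x-y\|$. **Proposition.** There exist a non-empty open convex set $\Omega\subset\mathbb{R}^2$ and $F\in\mathcal{F}^1(\Omega)$ such that $$\operatorname{Lip}(\nabla f;\Omega)<\Gamma^1(F;\Omega).$$ Moreover, $\Omega$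 can be chosen strictly convex, that is, such that every point strictly between two distinct points of $\overline{\Omega}$ belongs to $\Omega$. -/

import Mathlib

noncomputable section

/-- A `1`-field on `Ω ⊆ ℝⁿ`: every point `x` of `Ω` carries the polynomial of degree at most one
`a ↦ f_x + ⟨D_x f, a - x⟩`, recorded through its value `f_x` at `x` and its gradient `D_x f`. -/
structure OneField {n : ℕ} (Ω : Set (EuclideanSpace ℝ (Fin n))) where
  /-- the number `f_x` -/
  val : Ω → ℝ
  /-- the vector `D_x f` -/
  grad : Ω → EuclideanSpace ℝ (Fin n)

namespace OneField

/-- The polynomial `F(x)`, that is `a ↦ f_x + ⟨D_x f, a - x⟩`. -/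
def poly {n : ℕ} {Ω : Set (EuclideanSpace ℝ (Fin n))} (F : OneField Ω) (x : Ω)
    (a : EuclideanSpace ℝ (Fin n)) : ℝ :=
  F.val x + inner ℝ (F.grad x) (a - (x : EuclideanSpace ℝ (Fin n)))

/-- `Γ¹(F; x, y) = 2 sup_a |F(x)(a) - F(y)(a)| / (‖x - a‖² + ‖y - a‖²)` (used for `x ≠ y`, where
the denominator is positive), as an extended nonnegative real. -/
def gammaPair {n : ℕ} {Ω : Set (EuclideanSpace ℝ (Fin n))} (F : OneField Ω) (x y : Ω) : ENNReal :=
  2 * ⨆ a : EuclideanSpace ℝ (Fin n),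
    ENNReal.ofReal (|F.poly x a - F.poly y a| /
      (‖(x : EuclideanSpace ℝ (Fin n)) - a‖ ^ 2 + ‖(y : EuclideanSpace ℝ (Fin n)) - a‖ ^ 2))

/-- `Γ¹(F; Ω)`, the supremum of `Γ¹(F; x, y)` over distinct points `x, y` of `Ω`. -/
def gamma {n : ℕ} {Ω : Set (EuclideanSpace ℝ (Fin n))} (F : OneField Ω) : ENNReal :=
  ⨆ (x : Ω) (y : Ω) (_ : x ≠ y), F.gammaPair x y

/-- `F ∈ 𝓕¹(Ω)`: the field is Taylorian, i.e. `Γ¹(F; Ω) < ∞`. -/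
def IsTaylorian {n : ℕ} {Ω : Set (EuclideanSpace ℝ (Fin n))} (F : OneField Ω) : Prop :=
  F.gamma < ⊤

open Classical in
/-- The function `f(x) = F(x)(x)` on `Ω`, given the value `0` outside `Ω`. For open `Ω` the values
outside do not affect derivatives at points of `Ω`. -/
def toFun {n : ℕ} {Ω : Set (EuclideanSpace ℝ (Fin n))} (F : OneField Ω)
    (x : EuclideanSpace ℝ (Fin n)) : ℝ :=
  if h : x ∈ Ω then F.poly ⟨x, h⟩ x else 0

end OneField

/-- `Lip(u; Ω)`, the supremum of `‖u x - u y‖ / ‖x - y‖` over distinct points `x, y` of `Ω`, as an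
extended nonnegative real. -/
def lipConst {n : ℕ} (u : EuclideanSpace ℝ (Fin n) → EuclideanSpace ℝ (Fin n))
    (Ω : Set (EuclideanSpace ℝ (Fin n))) : ENNReal :=
  ⨆ (x ∈ Ω) (y ∈ Ω) (_ : x ≠ y), ENNReal.ofReal (‖u x - u y‖ / ‖x - y‖)

/-- An open convex set is called strictly convex if its boundary contains no nondegenerate segment,
equivalently if every point strictly between two distinct points of its closure is an interior
point. (`StrictConvex ℝ Ω` itself holds for every open convex `Ω`, so the closure is used.) -/
def IsOpenStrictConvex {n : ℕ} (Ω : Set (EuclideanSpace ℝ (Fin n))) : Prop :=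
  IsOpen Ω ∧ Convex ℝ Ω ∧ ∀ x ∈ closure Ω, ∀ y ∈ closure Ω, x ≠ y → openSegment ℝ x y ⊆ Ω

end

/-!
The field is the `1`-jet of the harmonic cubic `f(t, s) = 6ts + t³/3 - ts²` on a thin ellipse
around the segment from `(-1, 0)` to `(1, 0)`.

*The gradient.* As `∇f` is quadratic, `∇f(x) - ∇f(y)` is exactly the Hessian of `f` at the midpoint
of `x` and `y`, applied to `x - y`. As `f` is harmonic, the Hessian at `(t, s)` is
`√(4t² + (6 - 2s)²)` times an isometry. On the ellipse this factor is at most `13/2`, so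
`Lip(∇f) ≤ 13/2` (`norm_cubicGrad_sub_le`, `lipConst_gradient_cubicField_le`).

*The field.* The two Taylor polynomials at `(±1, 0)` differ at `a = (0, -1)` by `40/3`, while
`‖x - a‖² + ‖y - a‖² = 4`; hence `Γ¹ ≥ 20/3` (`le_gamma_cubicField`). The point is that
tilting the Hessian of `6ts` along the segment by an angle of order `ε` raises its norm by `O(ε²)`
only, but changes the values of `f` at the endpoints by order `ε`, and `Γ¹` sees this to first
order. The ellipse has to be thin because the norm of the Hessian grows in the direction of
negative `s`.

*Finiteness of `Γ¹`.* Likewise the first-order Taylor remainder of a cubic at `y` is exactly half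
the Hessian at `y + (x - y)/3`, evaluated on `x - y`, so it is bounded by a multiple of
`‖x - y‖²` (`abs_cubic_remainder_le`), which together with the Lipschitz bound gives `Γ¹ < ∞`.
-/

/-! ### A thin ellipse -/

/-- The quadratic form `t² + 1000 s²`. -/
noncomputable def ellipseForm (x : EuclideanSpace ℝ (Fin 2)) : ℝ :=
  x 0 ^ 2 + 1000 * x 1 ^ 2

/-- The open ellipse `t² + 1000 s² < 5/4`. It contains the points `(±1, 0)`, and it is thin enough
for the Hessian of the cubic to have norm at most `13/2` on it. -/
noncomputable def thinEllipse : Set (EuclideanSpace ℝ (Fin 2)) :=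
  {x | ellipseForm x < 5 / 4}

lemma continuous_ellipseForm : Continuous ellipseForm := by
  unfold ellipseForm
  fun_prop

lemma ellipseForm_pos {x : EuclideanSpace ℝ (Fin 2)} (hx : x ≠ 0) : 0 < ellipseForm x := by
  unfold ellipseForm
  by_contra! h
  refine hx ?_
  have h0 : x 0 = 0 := by nlinarith [sq_nonneg (x 0), sq_nonneg (x 1)]
  have h1 : x 1 = 0 := by nlinarith [sq_nonneg (x 0), sq_nonneg (x 1)]
  ext i
  fin_cases i <;> simp [h0, h1]

lemma ellipseForm_combo (x y : EuclideanSpace ℝ (Fin 2)) {a b : ℝ} (hab : a + b = 1) :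
    ellipseForm (a • x + b • y)
      = a * ellipseForm x + b * ellipseForm y - a * b * ellipseForm (x - y) := by
  obtain rfl : b = 1 - a := by linarith
  simp only [ellipseForm, PiLp.add_apply, PiLp.smul_apply, PiLp.sub_apply, smul_eq_mul]
  ring

lemma isOpen_thinEllipse : IsOpen thinEllipse :=
  isOpen_lt continuous_ellipseForm continuous_const

lemma ellipseForm_le_of_mem_closure {x : EuclideanSpace ℝ (Fin 2)}
    (hx : x ∈ closure thinEllipse) : ellipseForm x ≤ 5 / 4 :=
  closure_lt_subset_le continuous_ellipseForm continuous_const hx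

lemma openSegment_subset_thinEllipse {x y : EuclideanSpace ℝ (Fin 2)}
    (hx : ellipseForm x ≤ 5 / 4) (hy : ellipseForm y ≤ 5 / 4) (hxy : x ≠ y) :
    openSegment ℝ x y ⊆ thinEllipse := by
  rintro _ ⟨a, b, ha, hb, hab, rfl⟩
  have hpos := mul_pos (mul_pos ha hb) (ellipseForm_pos (sub_ne_zero.mpr hxy))
  change ellipseForm _ < 5 / 4
  rw [ellipseForm_combo x y hab]
  nlinarith

lemma convex_thinEllipse : Convex ℝ thinEllipse := by
  rw [convex_iff_openSegment_subset]
  intro x hx y hy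
  rcases eq_or_ne x y with rfl | hxy
  · simpa using hx
  · exact openSegment_subset_thinEllipse (le_of_lt hx) (le_of_lt hy) hxy

lemma isOpenStrictConvex_thinEllipse : IsOpenStrictConvex thinEllipse :=
  ⟨isOpen_thinEllipse, convex_thinEllipse, fun _ hx _ hy hxy =>
    openSegment_subset_thinEllipse (ellipseForm_le_of_mem_closure hx)
      (ellipseForm_le_of_mem_closure hy) hxy⟩

/-! ### The harmonic cubic -/

/-- The harmonic cubic `6ts + t³/3 - ts²`. -/
noncomputable def cubic (x : EuclideanSpace ℝ (Fin 2)) : ℝ :=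
  6 * (x 0 * x 1) + x 0 ^ 3 / 3 - x 0 * x 1 ^ 2

/-- The gradient `(6s + t² - s², 6t - 2ts)` of `cubic`. -/
noncomputable def cubicGrad (x : EuclideanSpace ℝ (Fin 2)) : EuclideanSpace ℝ (Fin 2) :=
  !₂[6 * x 1 + x 0 ^ 2 - x 1 ^ 2, 6 * x 0 - 2 * (x 0 * x 1)]

lemma hasGradientAt_cubic (x : EuclideanSpace ℝ (Fin 2)) :
    HasGradientAt cubic (cubicGrad x) x := by
  rw [hasGradientAt_iff_hasFDerivAt]
  have h0 : HasFDerivAt (fun y : EuclideanSpace ℝ (Fin 2) => y 0)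
      (EuclideanSpace.proj (𝕜 := ℝ) (0 : Fin 2)) x :=
    (EuclideanSpace.proj (𝕜 := ℝ) (0 : Fin 2)).hasFDerivAt
  have h1 : HasFDerivAt (fun y : EuclideanSpace ℝ (Fin 2) => y 1)
      (EuclideanSpace.proj (𝕜 := ℝ) (1 : Fin 2)) x :=
    (EuclideanSpace.proj (𝕜 := ℝ) (1 : Fin 2)).hasFDerivAt
  have h := (((h0.mul h1).const_mul 6).add ((h0.pow 3).mul_const (1 / 3))).sub (h0.mul (h1.pow 2))
  refine (h.congr_fderiv ?_).congr_of_eventuallyEq (Filter.Eventually.of_forall fun y => ?_)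
  · ext v
    simp [cubicGrad, PiLp.inner_apply, Fin.sum_univ_two]
    ring
  · simp [cubic]
    ring

/-- The squared norm `4t² + (6 - 2s)²` of the Hessian of `cubic` is at most `(13/2)²` on the
ellipse. -/
lemma cubic_hessian_bound {x : EuclideanSpace ℝ (Fin 2)} (hx : x ∈ thinEllipse) :
    (2 * x 0) ^ 2 + (6 - 2 * x 1) ^ 2 ≤ (13 / 2) ^ 2 := by
  have h : x 0 ^ 2 + 1000 * x 1 ^ 2 < 5 / 4 := hx
  have h1 : -(1 / 24) ≤ x 1 := by
    by_contra! hlt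
    nlinarith [sq_nonneg (x 0)]
  nlinarith [sq_nonneg (x 1)]

lemma norm_cubicGrad_sub_le {x y : EuclideanSpace ℝ (Fin 2)}
    (hx : x ∈ thinEllipse) (hy : y ∈ thinEllipse) :
    ‖cubicGrad x - cubicGrad y‖ ≤ 13 / 2 * ‖x - y‖ := by
  have hm := cubic_hessian_bound (convex_thinEllipse hx hy (a := 1 / 2) (b := 1 / 2)
    (by norm_num) (by norm_num) (by norm_num))
  simp only [PiLp.add_apply, PiLp.smul_apply, smul_eq_mul] at hm
  refine (sq_le_sq₀ (norm_nonneg _) (by positivity)).mp ?_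
  have key : ‖cubicGrad x - cubicGrad y‖ ^ 2
      = ((2 * (1 / 2 * x 0 + 1 / 2 * y 0)) ^ 2 + (6 - 2 * (1 / 2 * x 1 + 1 / 2 * y 1)) ^ 2)
        * ‖x - y‖ ^ 2 := by
    simp only [EuclideanSpace.real_norm_sq_eq, Fin.sum_univ_two, PiLp.sub_apply, cubicGrad,
      Matrix.cons_val_zero, Matrix.cons_val_one]
    ring
  rw [key, mul_pow _ ‖x - y‖]
  exact mul_le_mul_of_nonneg_right hm (sq_nonneg _)

lemma abs_cubic_remainder_le {x y : EuclideanSpace ℝ (Fin 2)}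
    (hx : x ∈ thinEllipse) (hy : y ∈ thinEllipse) :
    |cubic x - cubic y - inner ℝ (cubicGrad y) (x - y)| ≤ 13 / 4 * ‖x - y‖ ^ 2 := by
  have hm := cubic_hessian_bound (convex_thinEllipse hx hy (a := 1 / 3) (b := 2 / 3)
    (by norm_num) (by norm_num) (by norm_num))
  simp only [PiLp.add_apply, PiLp.smul_apply, smul_eq_mul] at hm
  set p := 2 * (1 / 3 * x 0 + 2 / 3 * y 0) with hp
  set q := 6 - 2 * (1 / 3 * x 1 + 2 / 3 * y 1) with hq
  have key : cubic x - cubic y - inner ℝ (cubicGrad y) (x - y)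
      = (p * ((x 0 - y 0) ^ 2 - (x 1 - y 1) ^ 2) + q * (2 * (x 0 - y 0) * (x 1 - y 1))) / 2 := by
    simp only [cubic, cubicGrad, PiLp.inner_apply, Fin.sum_univ_two, PiLp.sub_apply,
      Matrix.cons_val_zero, Matrix.cons_val_one, RCLike.inner_apply, conj_trivial, hp, hq]
    ring
  have hn : ‖x - y‖ ^ 2 = (x 0 - y 0) ^ 2 + (x 1 - y 1) ^ 2 := by
    simp only [EuclideanSpace.real_norm_sq_eq, Fin.sum_univ_two, PiLp.sub_apply]
  rw [key, hn]
  generalize x 0 - y 0 = a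
  generalize x 1 - y 1 = b
  refine abs_le_of_sq_le_sq ?_ (by positivity)
  -- Cauchy–Schwarz, with `(a² - b²)² + (2ab)² = (a² + b²)²`.
  have hcs : (p * (a ^ 2 - b ^ 2) + q * (2 * a * b)) ^ 2
      ≤ (p ^ 2 + q ^ 2) * (a ^ 2 + b ^ 2) ^ 2 := by
    nlinarith [sq_nonneg (p * (2 * a * b) - q * (a ^ 2 - b ^ 2))]
  have := mul_le_mul_of_nonneg_right hm (sq_nonneg (a ^ 2 + b ^ 2))
  nlinarith

/-! ### The field of the cubic -/

/-- The `1`-field on the ellipse formed by the first-order Taylor polynomials of `cubic`. -/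
noncomputable def cubicField : OneField thinEllipse where
  val x := cubic x
  grad x := cubicGrad x

lemma hasGradientAt_cubicField (x : thinEllipse) :
    HasGradientAt cubicField.toFun (cubicField.grad x) (x : EuclideanSpace ℝ (Fin 2)) := by
  refine (hasGradientAt_cubic x).congr_of_eventuallyEq ?_
  filter_upwards [isOpen_thinEllipse.mem_nhds x.2] with y hy
  simp [OneField.toFun, hy, OneField.poly, cubicField]

lemma lipConst_gradient_cubicField_le :
    lipConst (gradient cubicField.toFun) thinEllipse ≤ ENNReal.ofReal (13 / 2) := by
  refine iSup₂_le fun x hx => iSup₂_le fun y hy => iSup_le fun hxy => ENNReal.ofReal_le_ofReal ?_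
  rw [(hasGradientAt_cubicField ⟨x, hx⟩).gradient, (hasGradientAt_cubicField ⟨y, hy⟩).gradient,
    div_le_iff₀ (norm_pos_iff.mpr (sub_ne_zero.mpr hxy))]
  exact norm_cubicGrad_sub_le hx hy

lemma abs_cubicField_poly_sub_le (x y : thinEllipse) (a : EuclideanSpace ℝ (Fin 2)) :
    |cubicField.poly x a - cubicField.poly y a| ≤ 20 *
      (‖(x : EuclideanSpace ℝ (Fin 2)) - a‖ ^ 2 + ‖(y : EuclideanSpace ℝ (Fin 2)) - a‖ ^ 2) := by
  obtain ⟨x, hx⟩ := x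
  obtain ⟨y, hy⟩ := y
  have key : cubicField.poly ⟨x, hx⟩ a - cubicField.poly ⟨y, hy⟩ a
      = (cubic x - cubic y - inner ℝ (cubicGrad y) (x - y))
        + inner ℝ (cubicGrad x - cubicGrad y) (a - x) := by
    simp only [OneField.poly, cubicField, inner_sub_left, inner_sub_right]
    ring
  have h1 := abs_cubic_remainder_le hx hy
  have h2 : |inner ℝ (cubicGrad x - cubicGrad y) (a - x)| ≤ 13 / 2 * ‖x - y‖ * ‖x - a‖ := by
    refine (abs_real_inner_le_norm _ _).trans ?_
    rw [norm_sub_rev a x]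
    gcongr
    exact norm_cubicGrad_sub_le hx hy
  have h3 : ‖x - y‖ ≤ ‖x - a‖ + ‖y - a‖ := by
    rw [norm_sub_rev y a]
    exact norm_sub_le_norm_sub_add_norm_sub x a y
  rw [key]
  refine (abs_add_le _ _).trans ?_
  have h4 := pow_le_pow_left₀ (norm_nonneg _) h3 2
  have h5 := mul_le_mul_of_nonneg_right h3 (norm_nonneg (x - a))
  nlinarith [sq_nonneg (‖x - a‖ - ‖y - a‖)]

lemma isTaylorian_cubicField : cubicField.IsTaylorian := by
  have h : cubicField.gamma ≤ 2 * ENNReal.ofReal 20 := by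
    refine iSup₂_le fun x y => iSup_le fun _ => ?_
    unfold OneField.gammaPair
    gcongr
    refine iSup_le fun a => ENNReal.ofReal_le_ofReal ?_
    exact div_le_of_le_mul₀ (by positivity) (by norm_num) (abs_cubicField_poly_sub_le x y a)
  exact h.trans_lt (ENNReal.mul_lt_top (by simp) ENNReal.ofReal_lt_top)

lemma le_gamma_cubicField : ENNReal.ofReal (20 / 3) ≤ cubicField.gamma := by
  have hx : (!₂[1, 0] : EuclideanSpace ℝ (Fin 2)) ∈ thinEllipse := by
    simp only [thinEllipse, ellipseForm, Set.mem_ofPred_eq, Matrix.cons_val_zero,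
      Matrix.cons_val_one]
    norm_num
  have hy : (!₂[-1, 0] : EuclideanSpace ℝ (Fin 2)) ∈ thinEllipse := by
    simp only [thinEllipse, ellipseForm, Set.mem_ofPred_eq, Matrix.cons_val_zero,
      Matrix.cons_val_one]
    norm_num
  have hxy : (⟨_, hx⟩ : thinEllipse) ≠ ⟨_, hy⟩ := by
    intro h
    have := congrArg (fun z : thinEllipse => (z : EuclideanSpace ℝ (Fin 2)) 0) h
    norm_num at this
  have hpair : ENNReal.ofReal (20 / 3) ≤ cubicField.gammaPair ⟨_, hx⟩ ⟨_, hy⟩ := by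
    have h2 : ENNReal.ofReal (20 / 3) = 2 * ENNReal.ofReal (10 / 3) := by
      rw [← ENNReal.ofReal_ofNat 2, ← ENNReal.ofReal_mul (by norm_num)]
      norm_num
    rw [h2]
    unfold OneField.gammaPair
    gcongr
    refine le_iSup_of_le !₂[0, -1] (ENNReal.ofReal_le_ofReal ?_)
    simp only [EuclideanSpace.real_norm_sq_eq, Fin.sum_univ_two, PiLp.sub_apply, OneField.poly,
      cubicField, cubic, cubicGrad, PiLp.inner_apply, Matrix.cons_val_zero,
      Matrix.cons_val_one, RCLike.inner_apply, conj_trivial]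
    norm_num [abs_of_nonpos, abs_of_nonneg]
  exact hpair.trans (le_iSup₂_of_le _ _ (le_iSup_of_le hxy le_rfl))

theorem mainTheorem10 :
    ∃ (Ω : Set (EuclideanSpace ℝ (Fin 2))) (F : OneField Ω),
      Ω.Nonempty ∧ IsOpenStrictConvex Ω ∧ F.IsTaylorian ∧
      (∀ x : Ω, HasGradientAt F.toFun (F.grad x) (x : EuclideanSpace ℝ (Fin 2))) ∧
      lipConst (gradient F.toFun) Ω < F.gamma := by
  refine ⟨thinEllipse, cubicField, ⟨0, ?_⟩, isOpenStrictConvex_thinEllipse,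
    isTaylorian_cubicField, hasGradientAt_cubicField, ?_⟩
  · norm_num [thinEllipse, ellipseForm]
  · refine lipConst_gradient_cubicField_le.trans_lt (lt_of_lt_of_le ?_ le_gamma_cubicField)
    exact (ENNReal.ofReal_lt_ofReal_iff (by norm_num)).mpr (by norm_num)
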